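/- Let $K$ be a field, let $x_1,\dots,x_n$ be indeterminates, and for $\alpha\in\mathbb N^n$ write $x^\alpha=x_1^{\alpha_1}\cdots x_n^{\alpha_n}$ (a *standard monomial*) in the free associative algebra $K\langle x_1,\dots,x_n\rangle$; $K$-linear combinations of standard monomials are called *standard polynomials*. A *monomial ordering* is a total well-ordering $>$ on $\mathbb N^n$ such that $\alpha>\beta$ implies $\alpha+\gamma>\beta+\gamma$ for all $\alpha,\beta,\gamma\in\mathbb N^n$; we write $x^\alpha > x^\beta$ for $\alpha>\beta$. For a nonzero standard polynomial $f=\sum_\alpha c_\alpha x^\alpha$, its leading exponent $\exp_>(f)$ is the largest $\alpha$ with $c_\alpha\neq 0$. Write $\epsilon_i=\exp_>(x_i)$ for the $i$-th unit vector. Let $$A=K\langle x_1,\dots,x_n \mid x_jx_i=c_{ij}\,x_ix_j+d_{ij},\ 1\le i<j\le n\rangle$$ be a $G$-algebra; that is, the $c_{ij}\in K$ are nonzero, the $d_{ij}$ are standard polynomials, and 1. there is a monomial ordering $>$ such that, for all $i<j$, $d_{ij}=0$ or $\epsilon_i+\epsilon_j>\exp_>(d_{ij})$ (every such ordering is called *admissible*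 for $A$); 2. for all $i<j<k$, the element $$c_{ik}c_{jk}\,d_{ij}x_k-x_kd_{ij}+c_{jk}\,x_jd_{ik}-c_{ij}\,d_{ik}x_j+d_{jk}x_i-c_{ij}c_{ik}\,x_id_{jk}$$ of $K\langle x_1,\dots,x_n\rangle$ reduces to zero with respect to the relations, i.e. it can be brought to $0$ by finitely many replacements of a term $a\,u\,x_jx_i\,v$ ($a\in K\setminus\{0\}$, $u,v$ words, $i<j$) by $a\,u\,(c_{ij}x_ix_j+d_{ij})\,v$. The standard monomials then represent a $K$-basis of $A$, so every $f\in A$ can be written uniquely as $f=\sum_\alpha c_\alpha x^\alpha$, and $\exp_>(f)$ is defined as above for $f\ne0$. For a nonzero left ideal $I\subset A$ put $\exp_>(I)=\{\exp_>(f)\mid f\in I\setminus\{0\}\}$. A *Gröbner basis* of $I$ with respect to an admissible ordering $>$ is a finite subset $\mathcal G\subset I\setminus\{0\}$ such that $\exp_>(I)=\bigcup_{g\in\mathcal G}(\exp_>(g)+\mathbb N^n)$. **Corollary (Finite Determinacy of Gröbner Bases).** Let $>$ be an admissible ordering for $A$, let $I$ be a nonzero left ideal of $A$, and let $\mathcal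 G$ be a Gröbner basis for $I$ with respect to $>$. There exists a finite set $F$ of standard monomials such that, if $>_1$ is any admissible ordering for $A$ which coincides with $>$ on $F$ (that is, $x^\alpha>x^\beta\iff x^\alpha>_1x^\beta$ for all $x^\alpha,x^\beta\in F$), then: 1. $\exp_>(g)=\exp_{>_1}(g)$ for all $g\in\mathcal G$; 2. $\mathcal G$ is a Gröbner basis for $I$ also with respect to $>_1$. -/

import Mathlib

open scoped MonomialOrder

noncomputable section

namespace GAlg

/-- The free associative algebra `K⟨x₁, …, xₙ⟩`: the monoid algebra over `K` of the free monoid of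
words in the letters `0, …, n - 1`. -/
abbrev Free (K : Type*) [Field K] (n : ℕ) : Type _ := MonoidAlgebra K (FreeMonoid (Fin n))

/-- The standard monomial `x^α = x₁^{α₁} ⋯ xₙ^{αₙ}`, as a word (in this order of the letters). -/
def stdWord {n : ℕ} (α : Fin n →₀ ℕ) : FreeMonoid (Fin n) :=
  (List.ofFn fun i => FreeMonoid.of i ^ α i).prod

/-- Coefficient families `α ↦ c_α` of standard polynomials `∑ c_α x^α`. The support of such a family
is the Newton diagram. -/
abbrev StdPoly (K : Type*) [Field K] (n : ℕ) : Type _ := (Fin n →₀ ℕ) →₀ K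

section Basic

variable {K : Type*} [Field K] {n : ℕ}

/-- A word, as an element of the free algebra. -/
def word (w : FreeMonoid (Fin n)) : Free K n := MonoidAlgebra.of K (FreeMonoid (Fin n)) w

/-- The generator `x_i` of the free algebra. -/
def X (i : Fin n) : Free K n := word (FreeMonoid.of i)

/-- The standard polynomial `∑ c_α x^α`, as an element of the free algebra. -/
def StdPoly.toFree : StdPoly K n →ₗ[K] Free K n :=
  Finsupp.linearCombination K fun α => word (stdWord α)

/-- The leading exponent with respect to a monomial ordering of a nonzero standard polynomial:
the largest element of its Newton diagram (`0` for the zero polynomial). -/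
def StdPoly.exp (m : MonomialOrder (Fin n)) (p : StdPoly K n) : Fin n →₀ ℕ :=
  m.toSyn.symm (p.support.sup m.toSyn)

end Basic

/-- The data `c_{ij}`, `d_{ij}` of commutation relations `x_j x_i = c_{ij} x_i x_j + d_{ij}`,
`i < j`, where the `d_{ij}` are standard polynomials. Only the entries with `i < j` are used. -/
structure Relations (K : Type*) [Field K] (n : ℕ) where
  c : Fin n → Fin n → K
  d : Fin n → Fin n → StdPoly K n

namespace Relations

variable {K : Type*} [Field K] {n : ℕ} (P : Relations K n)

/-- `d_{ij}` as an element of the free algebra. -/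
def dFree (i j : Fin n) : Free K n := StdPoly.toFree (P.d i j)

/-- The defining relations `x_j x_i = c_{ij} x_i x_j + d_{ij}` for `i < j`. -/
inductive Rel : Free K n → Free K n → Prop
  | comm (i j : Fin n) (hij : i < j) : Rel (X j * X i) (P.c i j • (X i * X j) + P.dFree i j)

/-- The algebra `A = K⟨x₁, …, xₙ | x_j x_i = c_{ij} x_i x_j + d_{ij}, i < j⟩`, the quotient of the
free algebra by the two-sided ideal generated by the relations. -/
abbrev Alg : Type _ := RingQuot P.Rel

/-- The quotient map `K⟨x₁, …, xₙ⟩ → A`. -/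
def toAlg : Free K n →ₐ[K] P.Alg := RingQuot.mkAlgHom K P.Rel

/-- A monomial ordering is admissible if, for all `i < j`, `d_{ij} = 0` or
`exp (d_{ij}) < ε_i + ε_j`. -/
def Admissible (m : MonomialOrder (Fin n)) : Prop :=
  ∀ i j : Fin n, i < j →
    P.d i j = 0 ∨
      StdPoly.exp m (P.d i j) ≺[m] (Finsupp.single i 1 + Finsupp.single j 1)

/-- One reduction step in the free algebra with respect to the relations: a term
`a • u x_j x_i v` of `f`, `i < j`, is replaced by `a • u (c_{ij} x_i x_j + d_{ij}) v`. -/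
inductive Step : Free K n → Free K n → Prop
  | reduce (f : Free K n) (u v : FreeMonoid (Fin n)) (i j : Fin n) (hij : i < j)
      (hf : f.coeff (u * FreeMonoid.of j * FreeMonoid.of i * v) ≠ 0) :
      Step f (f - f.coeff (u * FreeMonoid.of j * FreeMonoid.of i * v) •
        (word u * (X j * X i - (P.c i j • (X i * X j) + P.dFree i j)) * word v))

/-- `f` reduces to zero with respect to the relations. -/
def ReducesToZero (f : Free K n) : Prop := Relation.ReflTransGen P.Step f 0

/-- The difference of the two ways of rewriting the overlap `x_k x_j x_i`, `i < j < k`. -/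
def overlap (i j k : Fin n) : Free K n :=
  (P.c i k * P.c j k) • (P.dFree i j * X k) - X k * P.dFree i j
    + P.c j k • (X j * P.dFree i k) - P.c i j • (P.dFree i k * X j)
    + P.dFree j k * X i - (P.c i j * P.c i k) • (X i * P.dFree j k)

/-- The algebra `A` given by these relations is a `G`-algebra. (Every monomial ordering of
`Fin n →₀ ℕ` can be realized on a copy of `Fin n →₀ ℕ`, so that orderings with values in `Type`
are all of them.) -/
structure IsGAlgebra : Prop where
  c_ne_zero : ∀ i j : Fin n, i < j → P.c i j ≠ 0
  exists_admissible : ∃ m : MonomialOrder.{0, 0} (Fin n), P.Admissible m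
  reduces : ∀ i j k : Fin n, i < j → j < k → P.ReducesToZero (P.overlap i j k)

/-- The element `∑ c_α x^α` of `A` with coefficients `c`. -/
def ofCoeffs : StdPoly K n →ₗ[K] P.Alg := P.toAlg.toLinearMap ∘ₗ StdPoly.toFree

/-- The coefficients of `f ∈ A` in the basis of standard monomials: the family `c` with
`f = ∑ c_α x^α`. It exists and is unique when `A` is a `G`-algebra, that is, `ofCoeffs` is then
bijective and this is its inverse map. -/
def coeffs (f : P.Alg) : StdPoly K n := Function.invFun P.ofCoeffs f

/-- The leading exponent `exp_>(f)` of `f ∈ A`, meaningful for `f ≠ 0`. -/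
def exp (m : MonomialOrder (Fin n)) (f : P.Alg) : Fin n →₀ ℕ := StdPoly.exp m (P.coeffs f)

/-- `exp_>(I) = {exp_>(f) | f ∈ I \ {0}}`. -/
def expSet (m : MonomialOrder (Fin n)) (I : Set P.Alg) : Set (Fin n →₀ ℕ) :=
  P.exp m '' (I \ {0})

/-- The finite set `G` is a left Gröbner basis of the left ideal `I` (`Ideal` means left ideal):
`G ⊆ I \ {0}` and `exp_>(I)` is the union of the sets `exp_>(g) + ℕⁿ`, `g ∈ G`. -/
structure IsGroebnerBasis (m : MonomialOrder (Fin n)) (I : Ideal P.Alg) (G : Finset P.Alg) :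
    Prop where
  subset : (G : Set P.Alg) ⊆ (I : Set P.Alg) \ {0}
  expSet_eq : P.expSet m I = ⋃ g ∈ G, Set.range fun γ : Fin n →₀ ℕ => P.exp m g + γ

end Relations

end GAlg

end

/-! Take for `F` all exponents occurring in elements of `G`. An ordering agreeing with `>` on `F`
selects the same leading exponents in `G` (`exp_eq_exp`). Multiplying by `x^γ` shifts any admissible
leading exponent by `γ` (`Admissible.exp_stdWord_mul`), so `exp_>(I)`, being the union of the cones
over `G`, lies in `exp_{>₁}(I)`.

Equality follows from `expSet_subset_of_subset`. Suppose that `f ∈ I` has `>₁`-leading exponent `α`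
outside `L = exp_>(I)`. Every exponent in `L` is a `>₁`-leading exponent of `I`, so the tail of `f`
can be reduced modulo `I` until no exponent of `L` remains (`supported_le_sup`). The result is an
element of `I`, nonzero because its `α`-coefficient is untouched, with no exponent in `L`. Its
`>`-leading exponent nevertheless belongs to `L`, a contradiction.

All of this needs the standard monomials to be a basis of `A`. Spanning is straightening of words
(`Admissible.exists_ofCoeffs_eq_word`). Independence is a diamond lemma argument: a normal form map
built from one chosen rewriting per word kills every relator (`Admissible.map_relator_eq_zero`),
because overlaps reduce to zero, and hence factors through `A`. -/

noncomputable section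

namespace GAlg

/-! ### Words: content, descents, inversions and the rank order. -/

section Words

variable {n : ℕ}

/-- The exponent vector counting the letters of a word. -/
def content (w : FreeMonoid (Fin n)) : Fin n →₀ ℕ :=
  (w.toList.map fun i => Finsupp.single i 1).sum

@[simp] lemma content_one : content (1 : FreeMonoid (Fin n)) = 0 := rfl

@[simp] lemma content_of (i : Fin n) : content (FreeMonoid.of i) = Finsupp.single i 1 := by
  simp [content]

@[simp] lemma content_mul (u v : FreeMonoid (Fin n)) :
    content (u * v) = content u + content v := by
  simp [content, FreeMonoid.toList_mul]

lemma content_pow (u : FreeMonoid (Fin n)) (k : ℕ) : content (u ^ k) = k • content u := by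
  induction k with
  | zero => simp
  | succ k ih => rw [pow_succ, content_mul, ih, succ_nsmul]

lemma content_list_prod (l : List (FreeMonoid (Fin n))) :
    content l.prod = (l.map content).sum := by
  induction l with
  | nil => simp
  | cons a l ih => simp [ih]

@[simp] lemma content_stdWord (α : Fin n →₀ ℕ) : content (stdWord α) = α := by
  rw [stdWord, content_list_prod, List.map_ofFn, List.sum_ofFn]
  simp only [Function.comp_apply, content_pow, content_of]
  ext i
  simp

lemma content_apply (w : FreeMonoid (Fin n)) (i : Fin n) :
    content w i = w.toList.count i := by
  induction w using FreeMonoid.inductionOn' with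
  | one => rfl
  | of_mul a w ih =>
    rw [content_mul, Finsupp.add_apply, ih, content_of, FreeMonoid.toList_of_mul, List.count_cons,
      Finsupp.single_apply, add_comm]
    simp

lemma toList_pow_of (i : Fin n) (k : ℕ) :
    (FreeMonoid.of i ^ k).toList = List.replicate k i := by
  induction k with
  | zero => rfl
  | succ k ih => rw [pow_succ', FreeMonoid.toList_of_mul, ih, List.replicate_succ]

lemma pairwise_stdWord (α : Fin n →₀ ℕ) : (stdWord α).toList.Pairwise (· ≤ ·) := by
  rw [stdWord, FreeMonoid.toList_prod, List.map_ofFn, List.pairwise_flatten]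
  constructor
  · intro l hl
    obtain ⟨i, rfl⟩ := (List.mem_ofFn' _ _).1 hl
    simp [toList_pow_of, List.pairwise_replicate]
  · rw [List.pairwise_ofFn]
    intro i j hij x hx y hy
    simp only [Function.comp_apply, toList_pow_of] at hx hy
    rw [List.eq_of_mem_replicate hx, List.eq_of_mem_replicate hy]
    exact hij.le

/-- A word has a descent if some letter is directly followed by a smaller one. -/
def HasDescent (w : FreeMonoid (Fin n)) : Prop :=
  ∃ (u v : FreeMonoid (Fin n)) (i j : Fin n), i < j ∧
    w = u * FreeMonoid.of j * FreeMonoid.of i * v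

/-- Without descents the word is sorted, and a sorted list is determined by its letter counts. -/
lemma stdWord_content_of_not_hasDescent {w : FreeMonoid (Fin n)} (hw : ¬ HasDescent w) :
    stdWord (content w) = w := by
  apply FreeMonoid.toList.injective
  refine List.Perm.eq_of_pairwise' (r := (· ≤ ·)) (pairwise_stdWord _) ?_ ?_
  · rw [← List.isChain_iff_pairwise, List.isChain_iff_forall_rel_of_append_cons_cons]
    intro a b u v h
    by_contra hab
    exact hw ⟨FreeMonoid.ofList u, FreeMonoid.ofList v, b, a, not_le.1 hab,
      FreeMonoid.toList.injective (by simp [FreeMonoid.toList_mul, h])⟩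
  · rw [List.perm_iff_count]
    intro a
    rw [← content_apply, ← content_apply, content_stdWord]

/-- The number of inversions of a list of letters. -/
def inversions : List (Fin n) → ℕ
  | [] => 0
  | a :: l => l.countP (· < a) + inversions l

/-- The swap removes the inversion between the two adjacent letters and keeps the relative order of
every other pair. -/
lemma inversions_swap_lt (u v : List (Fin n)) {i j : Fin n} (hij : i < j) :
    inversions (u ++ i :: j :: v) < inversions (u ++ j :: i :: v) := by
  induction u with
  | nil => simp [inversions, hij, hij.not_gt]; omega
  | cons a u ih =>
    simp only [List.cons_append, inversions, List.countP_append, List.countP_cons]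
    omega

lemma not_hasDescent_stdWord (α : Fin n →₀ ℕ) : ¬ HasDescent (stdWord α) := by
  rintro ⟨u, v, i, j, hij, h⟩
  have hp := pairwise_stdWord α
  rw [h] at hp
  simp only [FreeMonoid.toList_mul, FreeMonoid.toList_of, List.append_assoc,
    List.pairwise_append] at hp
  exact absurd (hp.2.1.2.2 j (by simp) i (by simp)) (not_le.2 hij)

/-- Words are compared by content, then by the number of inversions. -/
def rank (m : MonomialOrder (Fin n)) (w : FreeMonoid (Fin n)) : m.syn ×ₗ ℕ :=
  toLex (m.toSyn (content w), inversions w.toList)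

variable {m : MonomialOrder (Fin n)}

lemma rank_lt_of_content_lt {v w : FreeMonoid (Fin n)} (h : content v ≺[m] content w) :
    rank m v < rank m w :=
  Prod.Lex.toLex_lt_toLex.2 (Or.inl h)

lemma rank_swap_lt (u v : FreeMonoid (Fin n)) {i j : Fin n} (hij : i < j) :
    rank m (u * FreeMonoid.of i * FreeMonoid.of j * v) <
      rank m (u * FreeMonoid.of j * FreeMonoid.of i * v) := by
  refine Prod.Lex.toLex_lt_toLex.2 (Or.inr ⟨?_, ?_⟩)
  · simp only [content_mul, content_of]
    congr 1
    abel
  · simpa [FreeMonoid.toList_mul] using inversions_swap_lt u.toList v.toList hij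

lemma rank_wellFounded (m : MonomialOrder (Fin n)) :
    WellFounded fun v w : FreeMonoid (Fin n) => rank m v < rank m w :=
  InvImage.wf (rank m) wellFounded_lt

/-- Relative position of two occurrences of two-letter factors in a word, the first one starting
no later than the second one. -/
lemma factor_cases {u v u' v' : List (Fin n)} {i j i' j' : Fin n}
    (h : u ++ j :: i :: v = u' ++ j' :: i' :: v') (hl : u.length ≤ u'.length) :
    (u = u' ∧ j = j' ∧ i = i' ∧ v = v') ∨ (u' = u ++ [j] ∧ i = j' ∧ v = i' :: v') ∨
      ∃ b, u' = u ++ j :: i :: b ∧ v = b ++ j' :: i' :: v' := by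
  rcases List.append_eq_append_iff.1 h with ⟨s, hs, hs'⟩ | ⟨s, hs, hs'⟩
  · rcases s with _ | ⟨a, _ | ⟨b, s⟩⟩ <;> simp_all
  · have : s = [] := by
      rw [hs] at hl
      simp at hl
      exact hl
    simp_all

end Words

/-! ### Subspaces of the free algebra spanned by sets of words. -/

section WordSpan

variable {K : Type*} [Field K] {n : ℕ}

@[simp] lemma word_mul_word (u v : FreeMonoid (Fin n)) :
    (word u * word v : Free K n) = word (u * v) := (map_mul _ _ _).symm

lemma word_one : (word 1 : Free K n) = 1 := map_one _

/-- The elements of the free algebra all of whose words lie in `S`. -/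
def wordSpan (K : Type*) [Field K] {n : ℕ} (S : Set (FreeMonoid (Fin n))) :
    Submodule K (Free K n) where
  carrier := {f | ∀ w, f.coeff w ≠ 0 → w ∈ S}
  zero_mem' := by simp
  add_mem' {f g} hf hg w hw := by
    by_cases h : f.coeff w = 0
    · exact hg w fun h' => hw (by simp [h, h'])
    · exact hf w h
  smul_mem' a f hf w hw := hf w fun h => hw (by simp [h])

lemma word_mem_wordSpan {S : Set (FreeMonoid (Fin n))} {w : FreeMonoid (Fin n)} (hw : w ∈ S) :
    word w ∈ wordSpan K S := by
  classical
  intro v hv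
  by_cases h : w = v
  · exact h ▸ hw
  · simp [word, h] at hv

lemma eq_sum_word (f : Free K n) : f = f.coeff.sum fun w a => a • word w := by
  conv_lhs => rw [← MonoidAlgebra.sum_coeff_single f]
  simp [word]

lemma wordSpan_le {S : Set (FreeMonoid (Fin n))} {W : Submodule K (Free K n)}
    (h : ∀ w ∈ S, word w ∈ W) : wordSpan K S ≤ W := by
  intro f hf
  rw [eq_sum_word f]
  exact W.sum_mem fun w hw => W.smul_mem _ (h w (hf w (Finsupp.mem_support_iff.1 hw)))

lemma map_eq_zero_of_mem_wordSpan {M : Type*} [AddCommGroup M] [Module K M]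
    {S : Set (FreeMonoid (Fin n))} {f : Free K n} (hf : f ∈ wordSpan K S) (L : Free K n →ₗ[K] M)
    (h : ∀ w ∈ S, L (word w) = 0) : L f = 0 :=
  wordSpan_le (W := LinearMap.ker L) h hf

lemma mul_word_mem_wordSpan {S T : Set (FreeMonoid (Fin n))} {f : Free K n}
    (hf : f ∈ wordSpan K S) {u v : FreeMonoid (Fin n)} (h : ∀ w ∈ S, u * w * v ∈ T) :
    word u * f * word v ∈ wordSpan K T := by
  refine wordSpan_le (W := (wordSpan K T).comap (LinearMap.mulLeftRight K (word u, word v))) ?_ hf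
  intro w hw
  simpa using word_mem_wordSpan (K := K) (h w hw)

lemma toFree_mem_wordSpan {S : Set (FreeMonoid (Fin n))} {p : StdPoly K n}
    (h : ∀ α ∈ p.support, stdWord α ∈ S) : StdPoly.toFree p ∈ wordSpan K S := by
  rw [StdPoly.toFree, Finsupp.linearCombination_apply]
  exact Submodule.sum_mem _ fun α hα => Submodule.smul_mem _ _ (word_mem_wordSpan (h α hα))

end WordSpan

/-! ### Rewriting and the normal form map. -/

namespace Relations

variable {K : Type*} [Field K] {n : ℕ} (P : Relations K n)

/-- The right-hand side `c_{ij} x_i x_j + d_{ij}` of a defining relation. -/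
def rhs (i j : Fin n) : Free K n := P.c i j • (X i * X j) + P.dFree i j

/-- The defining relator `x_j x_i - (c_{ij} x_i x_j + d_{ij})`. -/
def relator (i j : Fin n) : Free K n := X j * X i - P.rhs i j

lemma le_exp (m : MonomialOrder (Fin n)) (p : StdPoly K n) {β : Fin n →₀ ℕ} (hβ : β ∈ p.support) :
    β ≼[m] StdPoly.exp m p := by
  rw [StdPoly.exp, AddEquiv.apply_symm_apply]
  exact Finset.le_sup hβ

variable {P} {m : MonomialOrder (Fin n)}

lemma Admissible.lt_of_mem_support (hm : P.Admissible m) {i j : Fin n} (hij : i < j)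
    {δ : Fin n →₀ ℕ} (hδ : δ ∈ (P.d i j).support) :
    δ ≺[m] (Finsupp.single i 1 + Finsupp.single j 1) := by
  rcases hm i j hij with h | h
  · simp [h] at hδ
  · exact (le_exp m _ hδ).trans_lt h

lemma Admissible.dFree_mem_wordSpan (hm : P.Admissible m) {i j : Fin n} (hij : i < j) :
    P.dFree i j ∈
      wordSpan K {w | content w ≺[m] (Finsupp.single i 1 + Finsupp.single j 1)} :=
  toFree_mem_wordSpan fun δ hδ => by simpa using hm.lt_of_mem_support hij hδ

lemma X_mul_X (i j : Fin n) : (X i * X j : Free K n) = word (FreeMonoid.of i * FreeMonoid.of j) :=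
  word_mul_word _ _

lemma content_mul_lt {u t v : FreeMonoid (Fin n)} {β : Fin n →₀ ℕ} (h : content t ≺[m] β) :
    content (u * t * v) ≺[m] (content u + β + content v) := by
  simpa using h

/-- The swapped word has the same content and fewer inversions; the words of `d_{ij}` have smaller
content by admissibility. Quantifying over `u` and `v` lets the bound be used in any context. -/
lemma Admissible.rhs_mem_wordSpan (hm : P.Admissible m) {i j : Fin n} (hij : i < j) :
    P.rhs i j ∈ wordSpan K {t | ∀ u v : FreeMonoid (Fin n),
      rank m (u * t * v) < rank m (u * FreeMonoid.of j * FreeMonoid.of i * v)} := by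
  refine add_mem (Submodule.smul_mem _ _ ?_) ?_
  · rw [X_mul_X]
    exact word_mem_wordSpan fun u v => by simpa [mul_assoc] using rank_swap_lt u v hij
  · refine wordSpan_le (fun t ht => word_mem_wordSpan fun u v => rank_lt_of_content_lt ?_)
      (hm.dFree_mem_wordSpan hij)
    refine (content_mul_lt ht).trans_eq ?_
    simp only [content_mul, content_of]
    congr 1
    abel

variable (P m) in
open Classical in
/-- The normal form of a word, obtained by repeatedly rewriting one chosen descent. -/
def wordNormalForm : FreeMonoid (Fin n) → StdPoly K n :=
  (rank_wellFounded m).fix fun w rec =>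
    -- The definition does not assume admissibility, so recursive calls are guarded; for an
    -- admissible ordering the default `0` is never reached.
    let rec' : FreeMonoid (Fin n) → StdPoly K n := fun t =>
      if ht : rank m t < rank m w then rec t ht else 0
    if h : HasDescent w then
      let u := h.choose
      let v := h.choose_spec.choose
      let i := h.choose_spec.choose_spec.choose
      let j := h.choose_spec.choose_spec.choose_spec.choose
      P.c i j • rec' (u * (FreeMonoid.of i * FreeMonoid.of j) * v) +
        (P.d i j).sum fun δ a => a • rec' (u * stdWord δ * v)
    else Finsupp.single (content w) 1

/-- Linear extension of a function on words. -/
def liftWords (N : FreeMonoid (Fin n) → StdPoly K n) : Free K n →ₗ[K] StdPoly K n where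
  toFun f := f.coeff.sum fun w a => a • N w
  map_add' f g := by
    rw [MonoidAlgebra.coeff_add]
    exact Finsupp.sum_add_index' (by simp) (by simp [add_smul])
  map_smul' a f := by
    rw [MonoidAlgebra.coeff_smul, Finsupp.sum_smul_index' (by simp), Finsupp.smul_sum]
    simp [mul_smul]

lemma liftWords_word (N : FreeMonoid (Fin n) → StdPoly K n) (w : FreeMonoid (Fin n)) :
    liftWords N (word w) = N w := by
  simp [liftWords, word]

/-- Only one relator per descending word is killed by construction. This uses admissibility alone;
the remaining relators require confluence. -/
lemma exists_normalForm (hm : P.Admissible m) :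
    ∃ Φ : Free K n →ₗ[K] StdPoly K n, (∀ α, Φ (word (stdWord α)) = Finsupp.single α 1) ∧
      ∀ w, HasDescent w → ∃ (u v : FreeMonoid (Fin n)) (i j : Fin n), i < j ∧
        w = u * FreeMonoid.of j * FreeMonoid.of i * v ∧
          Φ (word u * P.relator i j * word v) = 0 := by
  refine ⟨liftWords (wordNormalForm P m), fun α => ?_, fun w h => ?_⟩
  · rw [liftWords_word, wordNormalForm, WellFounded.fix_eq]
    simp [not_hasDescent_stdWord]
  -- A trivial equation whose right side alone is then unfolded, giving one step of the recursion.
  · have hN : wordNormalForm P m w = wordNormalForm P m w := rfl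
    conv_rhs at hN => rw [wordNormalForm, WellFounded.fix_eq, dif_pos h, ← wordNormalForm]
    set u := h.choose
    set v := h.choose_spec.choose
    set i := h.choose_spec.choose_spec.choose
    set j := h.choose_spec.choose_spec.choose_spec.choose
    obtain ⟨hij, hw⟩ : i < j ∧ w = u * FreeMonoid.of j * FreeMonoid.of i * v :=
      h.choose_spec.choose_spec.choose_spec.choose_spec
    refine ⟨u, v, i, j, hij, hw, ?_⟩
    change _ = P.c i j • (if _ : rank m (u * (FreeMonoid.of i * FreeMonoid.of j) * v) < rank m w
        then P.wordNormalForm m (u * (FreeMonoid.of i * FreeMonoid.of j) * v) else 0) +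
      (P.d i j).sum fun δ a => a • (if _ : rank m (u * stdWord δ * v) < rank m w
        then P.wordNormalForm m (u * stdWord δ * v) else 0) at hN
    have h₁ : rank m (u * (FreeMonoid.of i * FreeMonoid.of j) * v) < rank m w := by
      rw [hw]
      simpa [mul_assoc] using rank_swap_lt u v hij
    have h₂ : ∀ δ ∈ (P.d i j).support, rank m (u * stdWord δ * v) < rank m w := by
      intro δ hδ
      rw [hw]
      refine rank_lt_of_content_lt ((content_mul_lt (β := Finsupp.single i 1 + Finsupp.single j 1)
        (by simpa using hm.lt_of_mem_support hij hδ)).trans_eq ?_)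
      simp only [content_mul, content_of]
      congr 1
      abel
    have hd : word u * P.dFree i j * word v =
        (P.d i j).sum fun δ a => a • (word (u * stdWord δ * v) : Free K n) := by
      simp only [dFree, StdPoly.toFree, Finsupp.linearCombination_apply, Finsupp.sum,
        Finset.mul_sum, Finset.sum_mul, mul_smul_comm, smul_mul_assoc, word_mul_word]
    have hl : word u * P.relator i j * word v =
        word w - (P.c i j • word (u * (FreeMonoid.of i * FreeMonoid.of j) * v) +
          (P.d i j).sum fun δ a => a • (word (u * stdWord δ * v) : Free K n)) := by
      rw [← hd, relator, rhs, X_mul_X, X_mul_X, mul_sub, mul_add, sub_mul, add_mul, hw]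
      simp [mul_assoc]
    rw [hl, map_sub, sub_eq_zero, map_add, map_smul, Finsupp.sum, map_sum, liftWords_word, hN,
      dif_pos h₁, liftWords_word]
    congr 1
    refine Finset.sum_congr rfl fun δ hδ => ?_
    rw [map_smul, liftWords_word]
    simp only [dif_pos (h₂ δ hδ)]

end Relations

/-! ### Confluence: the diamond lemma. -/

namespace Relations

variable {K : Type*} [Field K] {n : ℕ} {P : Relations K n} {m : MonomialOrder (Fin n)}

/-- The first two terms are the two ways to start rewriting `x_k x_j x_i`. The other four are
relators in words of the same content with fewer inversions. -/
lemma overlap_eq (i j k : Fin n) :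
    P.overlap i j k = X k * P.relator i j - P.relator j k * X i
      - P.c j k • (X j * P.relator i k) - (P.c j k * P.c i k) • (P.relator i j * X k)
      + P.c i j • (P.relator i k * X j) + (P.c i j * P.c i k) • (X i * P.relator j k) := by
  simp only [overlap, relator, rhs, mul_sub, sub_mul, mul_add, add_mul, smul_sub, smul_add,
    mul_smul_comm, smul_mul_assoc, mul_assoc, smul_smul]
  module

lemma Admissible.dFree_mem_wordSpan_mul (hm : P.Admissible m) {i j : Fin n} (hij : i < j)
    (u v : FreeMonoid (Fin n)) {β : Fin n →₀ ℕ}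
    (hβ : β = content u + (Finsupp.single i 1 + Finsupp.single j 1) + content v) :
    word u * P.dFree i j * word v ∈ wordSpan K {t | content t ≺[m] β} :=
  mul_word_mem_wordSpan (hm.dFree_mem_wordSpan hij) fun _ ht => hβ ▸ content_mul_lt ht

/-- Each term is some `d` times the missing letter. Consequently a reduction of the overlap to zero
only meets relators in words of content below that of `x_k x_j x_i`. -/
lemma Admissible.overlap_mem_wordSpan (hm : P.Admissible m) {i j k : Fin n} (hij : i < j)
    (hjk : j < k) :
    P.overlap i j k ∈ wordSpan K {t | content t ≺[m]
      (Finsupp.single i 1 + Finsupp.single j 1 + Finsupp.single k 1)} := by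
  have left : ∀ {a b : Fin n}, a < b → ∀ c : Fin n, (Finsupp.single i 1 + Finsupp.single j 1 +
      Finsupp.single k 1 : Fin n →₀ ℕ) =
        Finsupp.single c 1 + (Finsupp.single a 1 + Finsupp.single b 1) →
      X c * P.dFree a b ∈ wordSpan K {t | content t ≺[m]
        (Finsupp.single i 1 + Finsupp.single j 1 + Finsupp.single k 1)} := by
    intro a b hab c h
    have := hm.dFree_mem_wordSpan_mul hab (FreeMonoid.of c) 1 (by simpa using h)
    rwa [word_one, mul_one] at this
  have right : ∀ {a b : Fin n}, a < b → ∀ c : Fin n, (Finsupp.single i 1 + Finsupp.single j 1 +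
      Finsupp.single k 1 : Fin n →₀ ℕ) =
        Finsupp.single a 1 + Finsupp.single b 1 + Finsupp.single c 1 →
      P.dFree a b * X c ∈ wordSpan K {t | content t ≺[m]
        (Finsupp.single i 1 + Finsupp.single j 1 + Finsupp.single k 1)} := by
    intro a b hab c h
    have := hm.dFree_mem_wordSpan_mul hab 1 (FreeMonoid.of c) (by simpa using h)
    rwa [word_one, one_mul] at this
  have hik := hij.trans hjk
  refine sub_mem (add_mem (sub_mem (add_mem (sub_mem (Submodule.smul_mem _ _ ?_) ?_)
    (Submodule.smul_mem _ _ ?_)) (Submodule.smul_mem _ _ ?_)) ?_) (Submodule.smul_mem _ _ ?_)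
  · exact right hij k (by abel)
  · exact left hij k (by abel)
  · exact left hik j (by abel)
  · exact right hik j (by abel)
  · exact right hjk i (by abel)
  · exact left hjk i (by abel)

lemma Admissible.relator_mem_wordSpan (hm : P.Admissible m) {i j : Fin n} (hij : i < j)
    (u v : FreeMonoid (Fin n)) {β : Fin n →₀ ℕ}
    (hβ : content (u * FreeMonoid.of j * FreeMonoid.of i * v) ≺[m] β) :
    word u * P.relator i j * word v ∈ wordSpan K {t | content t ≺[m] β} := by
  have hc : content u + (Finsupp.single i 1 + Finsupp.single j 1) + content v =
      content (u * FreeMonoid.of j * FreeMonoid.of i * v) := by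
    simp only [content_mul, content_of]
    abel
  rw [relator, rhs, mul_sub, sub_mul, mul_add, add_mul]
  refine sub_mem ?_ (add_mem ?_ ?_)
  · rw [X_mul_X, word_mul_word, word_mul_word]
    exact word_mem_wordSpan (by simpa [mul_assoc, add_assoc] using hβ)
  · rw [mul_smul_comm, smul_mul_assoc, X_mul_X, word_mul_word, word_mul_word]
    refine Submodule.smul_mem _ _ (word_mem_wordSpan ?_)
    rw [← hc] at hβ
    simpa only [content_mul, content_of, Set.mem_ofPred_eq] using hβ
  · refine wordSpan_le (fun t ht => word_mem_wordSpan ?_) (hm.dFree_mem_wordSpan_mul hij u v hc.symm)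
    exact lt_trans ht hβ

/-- A linear map that kills all relators in small words also kills the elements which reduce to
zero through small words. -/
lemma Admissible.map_eq_zero_of_reducesToZero (hm : P.Admissible m) {M : Type*} [AddCommGroup M]
    [Module K M] (Φ : Free K n →ₗ[K] M) (u v : FreeMonoid (Fin n)) (β : Fin n →₀ ℕ)
    (H : ∀ (a b : FreeMonoid (Fin n)) (i j : Fin n), i < j →
      content (a * FreeMonoid.of j * FreeMonoid.of i * b) ≺[m] (content u + β + content v) →
        Φ (word a * P.relator i j * word b) = 0)
    {f : Free K n} (hf : P.ReducesToZero f) (hfβ : f ∈ wordSpan K {t | content t ≺[m] β}) :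
    Φ (word u * f * word v) = 0 := by
  induction hf using Relation.ReflTransGen.head_induction_on with
  | refl => simp
  | head hstep _ ih =>
    obtain ⟨a, b, i, j, hij, hcoeff⟩ := hstep
    have hlt := hfβ _ hcoeff
    -- A reduction step stays in the span of small words, so the bound passes to the rest of the
    -- reduction.
    have ih' := ih (sub_mem hfβ (Submodule.smul_mem _ _ (hm.relator_mem_wordSpan hij a b hlt)))
    have h0 := H (u * a) (b * v) i j hij
      (by simpa [mul_assoc, add_assoc] using content_mul_lt (u := u) (v := v) hlt)
    rw [mul_sub, sub_mul, map_sub, mul_smul_comm, smul_mul_assoc, map_smul] at ih'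
    rw [← word_mul_word, ← word_mul_word] at h0
    change _ - _ • Φ (word u * (word a * P.relator i j * word b) * word v) = 0 at ih'
    rwa [show word u * (word a * P.relator i j * word b) * word v =
      word u * word a * P.relator i j * (word b * word v) by simp only [mul_assoc], h0, smul_zero,
      sub_zero] at ih'

section Confluence

variable {M : Type*} [AddCommGroup M] [Module K M] (Φ : Free K n →ₗ[K] M)

/-- The map `Φ` kills all relators in words of rank less than `r`. -/
def KillsBelow (P : Relations K n) (m : MonomialOrder (Fin n)) (r : m.syn ×ₗ ℕ) : Prop :=
  ∀ (a b : FreeMonoid (Fin n)) (i j : Fin n), i < j →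
    rank m (a * FreeMonoid.of j * FreeMonoid.of i * b) < r →
      Φ (word a * P.relator i j * word b) = 0

variable {Φ}

/-- The two sides differ by relator times right-hand side minus right-hand side times relator. Each
right-hand side lowers the rank, so `KillsBelow` disposes of both products. -/
lemma Admissible.map_relator_disjoint (hm : P.Admissible m) {i j i' j' : Fin n} (hij : i < j)
    (hij' : i' < j') (u b v : FreeMonoid (Fin n))
    (H : KillsBelow Φ P m (rank m (u * FreeMonoid.of j * FreeMonoid.of i *
      (b * FreeMonoid.of j' * FreeMonoid.of i' * v)))) :
    Φ (word u * P.relator i j * word (b * FreeMonoid.of j' * FreeMonoid.of i' * v)) =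
      Φ (word (u * FreeMonoid.of j * FreeMonoid.of i * b) * P.relator i' j' * word v) := by
  have h₁ : Φ (word u * P.relator i j * word b * P.rhs i' j' * word v) = 0 := by
    refine map_eq_zero_of_mem_wordSpan (hm.rhs_mem_wordSpan hij')
      (Φ ∘ₗ LinearMap.mulLeftRight K (word u * P.relator i j * word b, word v)) fun t ht => ?_
    have h := H u (b * t * v) i j hij
      (by simpa only [mul_assoc] using ht (u * FreeMonoid.of j * FreeMonoid.of i * b) v)
    simpa only [← word_mul_word, mul_assoc, LinearMap.comp_apply,
      LinearMap.mulLeftRight_apply] using h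
  have h₂ : Φ (word u * P.rhs i j * (word b * P.relator i' j' * word v)) = 0 := by
    refine map_eq_zero_of_mem_wordSpan (hm.rhs_mem_wordSpan hij)
      (Φ ∘ₗ LinearMap.mulLeftRight K (word u, word b * P.relator i' j' * word v)) fun t ht => ?_
    have h := H (u * t * b) v i' j' hij'
      (by simpa only [mul_assoc] using ht u (b * FreeMonoid.of j' * FreeMonoid.of i' * v))
    simpa only [← word_mul_word, mul_assoc, LinearMap.comp_apply,
      LinearMap.mulLeftRight_apply] using h
  have h₃ : word u * P.relator i j * word (b * FreeMonoid.of j' * FreeMonoid.of i' * v) -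
      word (u * FreeMonoid.of j * FreeMonoid.of i * b) * P.relator i' j' * word v =
      word u * P.relator i j * word b * P.rhs i' j' * word v -
        word u * P.rhs i j * (word b * P.relator i' j' * word v) := by
    simp only [← word_mul_word, relator, X]
    noncomm_ring
  rw [← sub_eq_zero, ← map_sub, h₃, map_sub, h₁, h₂, sub_zero]

/-- In `overlap_eq` the four extra relators are killed because their words have fewer inversions,
and the overlap is killed because it reduces to zero through words of smaller content. What remains
is the asserted equality. -/
lemma Admissible.map_relator_overlap (hm : P.Admissible m) {i j k : Fin n} (hij : i < j)
    (hjk : j < k) (hred : P.ReducesToZero (P.overlap i j k)) (u v : FreeMonoid (Fin n))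
    (H : KillsBelow Φ P m (rank m (u * FreeMonoid.of k * FreeMonoid.of j *
      (FreeMonoid.of i * v)))) :
    Φ (word u * P.relator j k * word (FreeMonoid.of i * v)) =
      Φ (word (u * FreeMonoid.of k) * P.relator i j * word v) := by
  have hik := hij.trans hjk
  have hkji : rank m (u * FreeMonoid.of j * FreeMonoid.of k * (FreeMonoid.of i * v)) <
      rank m (u * FreeMonoid.of k * FreeMonoid.of j * (FreeMonoid.of i * v)) :=
    rank_swap_lt u _ hjk
  have hkji' : rank m (u * FreeMonoid.of k * FreeMonoid.of i * (FreeMonoid.of j * v)) <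
      rank m (u * FreeMonoid.of k * FreeMonoid.of j * (FreeMonoid.of i * v)) := by
    simpa only [mul_assoc] using rank_swap_lt (m := m) (u * FreeMonoid.of k) v hij
  have h₁ := H (u * FreeMonoid.of j) v i k hik (by simpa only [mul_assoc] using hkji)
  have h₂ := H u (FreeMonoid.of k * v) i j hij (lt_trans
    (by simpa only [mul_assoc] using rank_swap_lt (m := m) (u * FreeMonoid.of j) v hik) hkji)
  have h₃ := H u (FreeMonoid.of j * v) i k hik hkji'
  have h₄ := H (u * FreeMonoid.of i) v j k hjk (lt_trans
    (by simpa only [mul_assoc] using rank_swap_lt (m := m) u (FreeMonoid.of j * v) hik) hkji')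
  have h₅ : Φ (word u * P.overlap i j k * word v) = 0 := by
    refine hm.map_eq_zero_of_reducesToZero Φ u v _ (fun a b p q hpq hlt =>
      H a b p q hpq (rank_lt_of_content_lt (hlt.trans_eq ?_))) hred
      (hm.overlap_mem_wordSpan hij hjk)
    simp only [content_mul, content_of]
    congr 1
    abel
  rw [overlap_eq] at h₅
  simp only [mul_sub, sub_mul, mul_add, add_mul, mul_smul_comm, smul_mul_assoc, map_sub, map_add,
    map_smul] at h₅
  simp only [← word_mul_word, mul_assoc] at h₁ h₂ h₃ h₄
  simp only [mul_assoc, X, h₁, h₂, h₃, h₄, smul_zero, sub_zero, add_zero] at h₅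
  simp only [← word_mul_word, mul_assoc]
  exact (sub_eq_zero.1 h₅).symm

lemma Admissible.map_relator_eq_of_length_le (hm : P.Admissible m) (hP : P.IsGAlgebra)
    {u v u' v' : FreeMonoid (Fin n)} {i j i' j' : Fin n} (hij : i < j) (hij' : i' < j')
    (h : u * FreeMonoid.of j * FreeMonoid.of i * v =
      u' * FreeMonoid.of j' * FreeMonoid.of i' * v')
    (hl : u.toList.length ≤ u'.toList.length)
    (H : KillsBelow Φ P m (rank m (u * FreeMonoid.of j * FreeMonoid.of i * v))) :
    Φ (word u * P.relator i j * word v) = Φ (word u' * P.relator i' j' * word v') := by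
  have h' := congrArg FreeMonoid.toList h
  simp only [FreeMonoid.toList_mul, FreeMonoid.toList_of, List.append_assoc,
    List.singleton_append] at h'
  rcases factor_cases h' hl with ⟨hu, rfl, rfl, hv⟩ | ⟨hu, rfl, hv⟩ | ⟨b, hu, hv⟩
  · rw [FreeMonoid.toList.injective hu, FreeMonoid.toList.injective hv]
  · obtain rfl : u' = u * FreeMonoid.of j := FreeMonoid.toList.injective hu
    obtain rfl : v = FreeMonoid.of i' * v' := FreeMonoid.toList.injective hv
    exact hm.map_relator_overlap hij' hij (hP.reduces _ _ _ hij' hij) u v' H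
  · obtain rfl : u' = u * FreeMonoid.of j * FreeMonoid.of i * FreeMonoid.ofList b :=
      FreeMonoid.toList.injective (by simp [hu, FreeMonoid.toList_mul])
    obtain rfl : v = FreeMonoid.ofList b * FreeMonoid.of j' * FreeMonoid.of i' * v' :=
      FreeMonoid.toList.injective (by simpa [FreeMonoid.toList_mul] using hv)
    exact hm.map_relator_disjoint hij hij' u _ v' H

/-- Confluence: a linear map that kills one relator in each word having a descent kills all
relators. -/
theorem Admissible.map_relator_eq_zero (hm : P.Admissible m) (hP : P.IsGAlgebra)
    (hΦ : ∀ w, HasDescent w → ∃ (u v : FreeMonoid (Fin n)) (i j : Fin n), i < j ∧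
      w = u * FreeMonoid.of j * FreeMonoid.of i * v ∧ Φ (word u * P.relator i j * word v) = 0)
    (u v : FreeMonoid (Fin n)) {i j : Fin n} (hij : i < j) :
    Φ (word u * P.relator i j * word v) = 0 := by
  generalize hw : u * FreeMonoid.of j * FreeMonoid.of i * v = w
  induction w using (rank_wellFounded m).induction generalizing u v i j with
  | _ w ih =>
    have H : KillsBelow Φ P m (rank m w) := fun a b p q hpq hlt => ih _ hlt a b hpq rfl
    obtain ⟨u', v', i', j', hij', hw', h0⟩ := hΦ w ⟨u, v, i, j, hij, hw.symm⟩
    rw [← h0]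
    rcases le_total u.toList.length u'.toList.length with hl | hl
    · exact hm.map_relator_eq_of_length_le hP hij hij' (hw.trans hw') hl (hw ▸ H)
    · exact (hm.map_relator_eq_of_length_le hP hij' hij (hw'.symm.trans hw.symm) hl
        (hw' ▸ H)).symm

end Confluence

/-! ### Passage to the quotient: independence of the standard monomials. -/

lemma map_mul_mul_eq_zero {M : Type*} [AddCommGroup M] [Module K M] (Φ : Free K n →ₗ[K] M)
    {f : Free K n} (h : ∀ u v, Φ (word u * f * word v) = 0) (x y : Free K n) :
    Φ (x * f * y) = 0 := by
  have hx : ∀ g : Free K n, g ∈ wordSpan K Set.univ := fun _ _ _ => trivial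
  refine map_eq_zero_of_mem_wordSpan (hx y) (Φ ∘ₗ LinearMap.mulLeft K (x * f)) fun v _ => ?_
  have := map_eq_zero_of_mem_wordSpan (hx x) (Φ ∘ₗ LinearMap.mulRight K (f * word v))
    fun u _ => by simpa [mul_assoc] using h u v
  simpa [mul_assoc] using this

/-- A linear map on the free algebra killing all relators factors through `A`. -/
theorem map_eq_of_toAlg_eq {M : Type*} [AddCommGroup M] [Module K M] (Φ : Free K n →ₗ[K] M)
    (h : ∀ (u v : FreeMonoid (Fin n)) (i j : Fin n), i < j →
      Φ (word u * P.relator i j * word v) = 0) {f g : Free K n} (hfg : P.toAlg f = P.toAlg g) :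
    Φ f = Φ g := by
  -- The factors `x` and `y` are quantified so that the multiplicative closure of the relation can
  -- be absorbed into them.
  have key : ∀ {a b : Free K n}, RingQuot.Rel P.Rel a b → ∀ x y, Φ (x * (a - b) * y) = 0 := by
    intro a b hab
    induction hab with
    | of hr =>
      obtain ⟨i, j, hij⟩ := hr
      exact map_mul_mul_eq_zero Φ fun u v => h u v i j hij
    | add_left _ ih => simpa using ih
    | @mul_left a b c _ ih =>
      intro x y
      simpa [sub_mul, mul_assoc, mul_sub] using ih x (c * y)
    | @mul_right a b c _ ih =>
      intro x y
      simpa [sub_mul, mul_assoc, mul_sub] using ih (x * a) y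
  have hq : Quot.mk (RingQuot.Rel P.Rel) f = Quot.mk (RingQuot.Rel P.Rel) g := by
    have := congrArg RingQuot.toQuot hfg
    simpa [toAlg, RingQuot.mkAlgHom_def, RingQuot.mkRingHom_def] using this
  have hgen := Quot.eqvGen_exact hq
  clear hq hfg
  induction hgen with
  | rel a b hab => simpa [sub_eq_zero] using key hab 1 1
  | refl => rfl
  | symm a b _ ih => exact ih.symm
  | trans a b c _ _ ih₁ ih₂ => exact ih₁.trans ih₂

/-- The normal form map is a left inverse of `StdPoly.toFree` and, by confluence, factors through
`A`. -/
theorem ofCoeffs_injective (hP : P.IsGAlgebra) : Function.Injective P.ofCoeffs := by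
  obtain ⟨m, hm⟩ := hP.exists_admissible
  obtain ⟨Φ, hstd, hΦ⟩ := exists_normalForm hm
  have hid : Φ ∘ₗ StdPoly.toFree = LinearMap.id := by
    refine Finsupp.lhom_ext' fun α => LinearMap.ext_ring ?_
    simp [StdPoly.toFree, hstd]
  intro p q hpq
  have := map_eq_of_toAlg_eq Φ (fun u v i j hij => hm.map_relator_eq_zero hP hΦ u v hij)
    (f := StdPoly.toFree p) (g := StdPoly.toFree q) hpq
  simpa using (DFunLike.congr_fun hid p).symm.trans (this.trans (DFunLike.congr_fun hid q))

/-! ### Straightening: the standard monomials span. -/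

@[simp] lemma ofCoeffs_single (α : Fin n →₀ ℕ) (a : K) :
    P.ofCoeffs (Finsupp.single α a) = a • P.toAlg (word (stdWord α)) := by
  simp [ofCoeffs, StdPoly.toFree]

lemma toAlg_swap (P : Relations K n) (u v : FreeMonoid (Fin n)) {i j : Fin n} (hij : i < j) :
    P.toAlg (word (u * FreeMonoid.of j * FreeMonoid.of i * v)) =
      P.c i j • P.toAlg (word (u * FreeMonoid.of i * FreeMonoid.of j * v)) +
        (P.d i j).sum fun δ a => a • P.toAlg (word (u * stdWord δ * v)) := by
  have hrel : P.toAlg (X j * X i) = P.toAlg (P.rhs i j) :=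
    RingQuot.mkAlgHom_rel K (Rel.comm i j hij)
  have h : P.toAlg (word u * (X j * X i) * word v) = P.toAlg (word u * P.rhs i j * word v) := by
    simp only [map_mul] at hrel ⊢
    rw [hrel]
  have hd : word u * P.dFree i j * word v =
      (P.d i j).sum fun δ a => a • (word (u * stdWord δ * v) : Free K n) := by
    simp only [dFree, StdPoly.toFree, Finsupp.linearCombination_apply, Finsupp.sum,
      Finset.mul_sum, Finset.sum_mul, mul_smul_comm, smul_mul_assoc, word_mul_word]
  rw [rhs, mul_add, add_mul, hd, X_mul_X, X_mul_X, mul_smul_comm, smul_mul_assoc] at h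
  simpa only [word_mul_word, mul_assoc, map_add, map_smul, Finsupp.sum, map_sum] using h

/-- Straightening of words: in `A`, a word is a nonzero multiple of the standard monomial with the
same content plus smaller standard monomials. -/
theorem Admissible.exists_ofCoeffs_eq_word (hm : P.Admissible m)
    (hc : ∀ i j : Fin n, i < j → P.c i j ≠ 0) (w : FreeMonoid (Fin n)) :
    ∃ p : StdPoly K n, P.ofCoeffs p = P.toAlg (word w) ∧ p (content w) ≠ 0 ∧
      ∀ β ∈ p.support, β ≼[m] content w := by
  induction w using (rank_wellFounded m).induction with
  | _ w ih =>
    by_cases h : HasDescent w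
    · obtain ⟨u, v, i, j, hij, rfl⟩ := h
      have hcont : content (u * FreeMonoid.of i * FreeMonoid.of j * v) =
          content (u * FreeMonoid.of j * FreeMonoid.of i * v) := by
        simp only [content_mul, content_of]
        abel
      have hδ : ∀ δ ∈ (P.d i j).support, content (u * stdWord δ * v) ≺[m]
          content (u * FreeMonoid.of j * FreeMonoid.of i * v) := by
        intro δ hδ
        refine (content_mul_lt (β := Finsupp.single i 1 + Finsupp.single j 1)
          (by simpa using hm.lt_of_mem_support hij hδ)).trans_eq ?_
        simp only [content_mul, content_of]
        congr 1
        abel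
      obtain ⟨p, hp, hp0, hple⟩ := ih _ (rank_swap_lt u v hij)
      choose! q hq _ hqle using fun δ hd => ih (u * stdWord δ * v) (rank_lt_of_content_lt (hδ δ hd))
      have hqlt : ∀ δ ∈ (P.d i j).support, ∀ β ∈ (q δ).support,
          β ≺[m] content (u * FreeMonoid.of j * FreeMonoid.of i * v) :=
        fun δ hd β hβ => (hqle δ hd β hβ).trans_lt (hδ δ hd)
      rw [hcont] at hp0 hple
      refine ⟨P.c i j • p + (P.d i j).sum fun δ a => a • q δ, ?_, ?_, ?_⟩
      · rw [toAlg_swap P u v hij, map_add, map_smul, hp, Finsupp.sum, map_sum]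
        congr 1
        exact Finset.sum_congr rfl fun δ hd => by rw [map_smul, hq δ hd]
      -- The words coming from `d_{ij}` have strictly smaller content, so the top coefficient is
      -- `c_{ij}` times that of `p`.
      · rw [Finsupp.add_apply, Finsupp.sum, Finsupp.finsetSum_apply, Finset.sum_eq_zero, add_zero]
        · exact mul_ne_zero (hc i j hij) hp0
        · intro δ hd
          rw [Finsupp.smul_apply, (Finsupp.notMem_support_iff (f := q δ)).1, smul_zero]
          exact fun hβ => lt_irrefl _ (hqlt δ hd _ hβ)
      · intro β hβ
        by_contra hlt
        refine Finsupp.mem_support_iff.1 hβ ?_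
        rw [Finsupp.add_apply, Finsupp.sum, Finsupp.finsetSum_apply, Finset.sum_eq_zero, add_zero,
          Finsupp.smul_apply,
          (Finsupp.notMem_support_iff (f := p)).1 fun h => hlt (hple β h), smul_zero]
        intro δ hd
        rw [Finsupp.smul_apply,
          (Finsupp.notMem_support_iff (f := q δ)).1 fun h => hlt (hqlt δ hd β h).le,
          smul_zero]
    · refine ⟨Finsupp.single (content w) 1, ?_, by simp, ?_⟩
      · simp [stdWord_content_of_not_hasDescent h]
      · intro β hβ
        rw [Finset.mem_singleton.1 (Finsupp.support_single_subset hβ)]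

theorem ofCoeffs_surjective (hP : P.IsGAlgebra) : Function.Surjective P.ofCoeffs := by
  intro f
  obtain ⟨m, hm⟩ := hP.exists_admissible
  obtain ⟨f, rfl⟩ := RingQuot.mkAlgHom_surjective K P.Rel f
  refine wordSpan_le (W := (LinearMap.range P.ofCoeffs).comap P.toAlg.toLinearMap)
    (S := Set.univ) (fun w _ => ?_) (fun _ _ => trivial)
  obtain ⟨p, hp, -⟩ := hm.exists_ofCoeffs_eq_word hP.c_ne_zero w
  exact ⟨p, hp⟩

/-- The standard monomials form a basis of a `G`-algebra. -/
def coeffsEquiv (hP : P.IsGAlgebra) : P.Alg ≃ₗ[K] StdPoly K n :=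
  (LinearEquiv.ofBijective P.ofCoeffs ⟨ofCoeffs_injective hP, ofCoeffs_surjective hP⟩).symm

lemma coeffs_eq (hP : P.IsGAlgebra) (f : P.Alg) : P.coeffs f = coeffsEquiv hP f := by
  rw [coeffs, eq_comm, ← (ofCoeffs_injective hP).eq_iff,
    Function.invFun_eq (ofCoeffs_surjective hP f)]
  exact (LinearEquiv.ofBijective P.ofCoeffs _).apply_symm_apply f

lemma coeffsEquiv_ofCoeffs (hP : P.IsGAlgebra) (p : StdPoly K n) :
    coeffsEquiv hP (P.ofCoeffs p) = p :=
  (LinearEquiv.ofBijective P.ofCoeffs _).symm_apply_apply p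

lemma ofCoeffs_coeffsEquiv (hP : P.IsGAlgebra) (f : P.Alg) :
    P.ofCoeffs (coeffsEquiv hP f) = f :=
  (LinearEquiv.ofBijective P.ofCoeffs _).apply_symm_apply f

/-! ### Leading exponents in `A`. -/

lemma exp_mem_support {p : StdPoly K n} (hp : p ≠ 0) : StdPoly.exp m p ∈ p.support := by
  obtain ⟨β, hβ, h⟩ := Finset.exists_mem_eq_sup p.support (Finsupp.support_nonempty_iff.2 hp) m.toSyn
  rwa [StdPoly.exp, h, AddEquiv.symm_apply_apply]

lemma exp_eq_of_isGreatest {p : StdPoly K n} {α : Fin n →₀ ℕ} (hα : α ∈ p.support)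
    (h : ∀ β ∈ p.support, β ≼[m] α) : StdPoly.exp m p = α :=
  m.toSyn.injective (le_antisymm (h _ (exp_mem_support (by rintro rfl; simp at hα))) (le_exp m p hα))

/-- Multiplicativity of leading exponents for multiplication by a standard monomial. -/
theorem Admissible.exp_stdWord_mul (hm : P.Admissible m) (hP : P.IsGAlgebra) {g : P.Alg}
    (hg : g ≠ 0) (γ : Fin n →₀ ℕ) :
    P.toAlg (word (stdWord γ)) * g ≠ 0 ∧
      P.exp m (P.toAlg (word (stdWord γ)) * g) = P.exp m g + γ := by
  set q := coeffsEquiv hP g with hq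
  have hq0 : q ≠ 0 := by simpa [hq] using hg
  set α := StdPoly.exp m q with hα
  choose s hs hs0 hsle using fun β : Fin n →₀ ℕ =>
    hm.exists_ofCoeffs_eq_word hP.c_ne_zero (stdWord γ * stdWord β)
  simp only [content_mul, content_stdWord] at hs0 hsle
  have hprod : P.toAlg (word (stdWord γ)) * g = P.ofCoeffs (q.sum fun β a => a • s β) := by
    have hg' : g = q.sum fun β a => a • P.toAlg (word (stdWord β)) := by
      rw [← ofCoeffs_coeffsEquiv hP g, ← hq]
      simp [ofCoeffs, StdPoly.toFree, Finsupp.linearCombination_apply, Finsupp.sum]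
    rw [hg', Finsupp.sum, Finsupp.sum, map_sum, Finset.mul_sum]
    refine Finset.sum_congr rfl fun β _ => ?_
    rw [map_smul, hs, mul_smul_comm, ← map_mul, word_mul_word]
  have hmem : α + γ ∈ (q.sum fun β a => a • s β).support := by
    rw [Finsupp.mem_support_iff, Finsupp.sum, Finsupp.finsetSum_apply, Finset.sum_eq_single α]
    · rw [Finsupp.smul_apply, add_comm]
      exact smul_ne_zero (Finsupp.mem_support_iff.1 (exp_mem_support hq0)) (hs0 α)
    · intro β hβ hne
      rw [Finsupp.smul_apply, (Finsupp.notMem_support_iff (f := s β)).1, smul_zero]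
      -- If `α + γ` occurred in `s β`, then `α + γ ≤ γ + β`, hence `α ≤ β`, and maximality of `α`
      -- would give `β = α`.
      intro h
      have h1 := hsle β _ h
      rw [add_comm, map_add, map_add, add_le_add_iff_left] at h1
      exact hne (m.toSyn.injective (le_antisymm (le_exp m q hβ) h1))
    · exact fun h => absurd (exp_mem_support hq0) h
  have hle : ∀ δ ∈ (q.sum fun β a => a • s β).support, δ ≼[m] (α + γ) := by
    intro δ hδ
    by_contra hlt
    refine Finsupp.mem_support_iff.1 hδ ?_
    rw [Finsupp.sum, Finsupp.finsetSum_apply, Finset.sum_eq_zero]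
    intro β hβ
    rw [Finsupp.smul_apply, (Finsupp.notMem_support_iff (f := s β)).1, smul_zero]
    intro h
    refine hlt ((hsle β _ h).trans ?_)
    rw [add_comm, map_add, map_add]
    exact add_le_add_left (le_exp m q hβ) _
  constructor
  · intro h0
    have h1 := congrArg (coeffsEquiv hP) h0
    rw [hprod, coeffsEquiv_ofCoeffs, map_zero] at h1
    simp [h1] at hmem
  · rw [exp, exp, coeffs_eq hP, coeffs_eq hP, hprod, coeffsEquiv_ofCoeffs]
    exact exp_eq_of_isGreatest hmem hle

/-- Monomial orderings that agree on the support of a standard polynomial give it the same leading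
exponent. -/
lemma exp_eq_exp {m₁ : MonomialOrder (Fin n)} {p : StdPoly K n}
    (h : ∀ α ∈ p.support, ∀ β ∈ p.support, (β ≺[m] α ↔ β ≺[m₁] α)) :
    StdPoly.exp m p = StdPoly.exp m₁ p := by
  by_cases hp : p = 0
  · simp [hp, StdPoly.exp]
  · refine exp_eq_of_isGreatest (exp_mem_support hp) fun β hβ => not_lt.1 fun hlt => ?_
    exact not_lt.2 (le_exp m₁ p hβ) ((h _ hβ _ (exp_mem_support hp)).1 hlt)

/-! ### Comparing the leading exponents of an ideal for two orderings. -/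

/-- Full reduction: modulo a space `V` of standard polynomials in which every exponent of `L` is a
leading exponent, every standard polynomial is congruent to one without exponents in `L`. -/
lemma supported_le_sup (V : Submodule K (StdPoly K n)) (L : Set (Fin n →₀ ℕ))
    (hL : ∀ β ∈ L, ∃ h ∈ V, h ≠ 0 ∧ StdPoly.exp m h = β) (α : Fin n →₀ ℕ) :
    Finsupp.supported K K {β | β ≺[m] α} ≤
      (V ⊓ Finsupp.supported K K {β | β ≺[m] α}) ⊔ Finsupp.supported K K Lᶜ := by
  set U := (V ⊓ Finsupp.supported K K {β | β ≺[m] α}) ⊔ Finsupp.supported K K Lᶜ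
  have key : ∀ β : Fin n →₀ ℕ, β ≺[m] α → Finsupp.single β (1 : K) ∈ U := by
    intro β
    induction β using (InvImage.wf m.toSyn wellFounded_lt).induction with
    | _ β ih =>
      intro hβ
      by_cases hβL : β ∈ L
      · obtain ⟨h, hV, h0, rfl⟩ := hL β hβL
        have hmem := exp_mem_support (m := m) h0
        have hU : h ∈ U := Submodule.mem_sup_left
          ⟨hV, fun δ hδ => (le_exp m h hδ).trans_lt hβ⟩
        -- The tail of `h` has exponents below `β`, so induction applies. Subtracting it from `h`
        -- leaves a nonzero multiple of the monomial `β`.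
        have hrest : h - Finsupp.single (StdPoly.exp m h) (h (StdPoly.exp m h)) ∈ U := by
          rw [← Finsupp.erase_eq_sub_single, ← Finsupp.sum_single (Finsupp.erase _ h)]
          refine Submodule.sum_mem _ fun δ hδ => ?_
          rw [Finsupp.support_erase, Finset.mem_erase] at hδ
          have hlt : δ ≺[m] StdPoly.exp m h :=
            lt_of_le_of_ne (le_exp m h hδ.2) fun h' => hδ.1 (m.toSyn.injective h')
          rw [← mul_one (Finsupp.erase _ h δ), ← smul_eq_mul, ← Finsupp.smul_single]
          exact U.smul_mem _ (ih δ hlt (hlt.trans hβ))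
        have hs := U.sub_mem hU hrest
        rw [sub_sub_cancel, ← mul_one (h _), ← smul_eq_mul, ← Finsupp.smul_single] at hs
        exact (U.smul_mem_iff (Finsupp.mem_support_iff.1 hmem)).1 hs
      · exact Submodule.mem_sup_right (Finsupp.single_mem_supported K 1 hβL)
  rw [Finsupp.supported_eq_span_single, Submodule.span_le]
  rintro _ ⟨β, hβ, rfl⟩
  exact key β hβ

lemma exp_eq (hP : P.IsGAlgebra) (f : P.Alg) : P.exp m f = StdPoly.exp m (coeffsEquiv hP f) := by
  rw [exp, coeffs_eq hP]

/-- If every leading exponent of a left ideal with respect to one ordering is a leading exponent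
with respect to another one, then both orderings give the same leading exponents. -/
theorem expSet_subset_of_subset (hP : P.IsGAlgebra) {m₁ : MonomialOrder (Fin n)} (I : Ideal P.Alg)
    (h : P.expSet m I ⊆ P.expSet m₁ I) : P.expSet m₁ I ⊆ P.expSet m I := by
  rintro _ ⟨f, ⟨hfI, hf0⟩, rfl⟩
  by_contra hα
  set V : Submodule K (StdPoly K n) := (I.restrictScalars K).map (coeffsEquiv hP).toLinearMap
  set p := coeffsEquiv hP f with hp
  have hp0 : p ≠ 0 := by simpa [hp] using hf0
  rw [exp_eq hP, ← hp] at hα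
  set α := StdPoly.exp m₁ p
  have hlow : p - Finsupp.single α (p α) ∈ Finsupp.supported K K {β | β ≺[m₁] α} := by
    intro β hβ
    rw [← Finsupp.erase_eq_sub_single, Finset.mem_coe, Finsupp.support_erase,
      Finset.mem_erase] at hβ
    exact lt_of_le_of_ne (le_exp m₁ p hβ.2) fun h' => hβ.1 (m₁.toSyn.injective h')
  have hL : ∀ β ∈ P.expSet m I, ∃ q ∈ V, q ≠ 0 ∧ StdPoly.exp m₁ q = β := by
    intro β hβ
    obtain ⟨g, ⟨hgI, hg0⟩, rfl⟩ := h hβ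
    exact ⟨coeffsEquiv hP g, ⟨g, hgI, rfl⟩, by simpa using hg0, (exp_eq hP g).symm⟩
  -- Only the tail of `p` is reduced, and `q` has exponents strictly below `α`; hence `p - q` keeps
  -- the coefficient of `p` at `α`.
  obtain ⟨q, ⟨hqV, hqlow⟩, r, hr, hqr⟩ := Submodule.mem_sup.1 (supported_le_sup V _ hL α hlow)
  have hpq : p - q = Finsupp.single α (p α) + r := by
    rw [sub_eq_iff_eq_add]
    exact (eq_sub_iff_add_eq.1 hqr).symm.trans (by abel)
  have hpqα : (p - q) α ≠ 0 := by
    have : q α = 0 := Finsupp.notMem_support_iff.1 fun h' => lt_irrefl _ (hqlow h')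
    rw [Finsupp.sub_apply, this, sub_zero]
    exact Finsupp.mem_support_iff.1 (exp_mem_support hp0)
  have hpq0 : p - q ≠ 0 := fun h' => hpqα (by rw [h', Finsupp.zero_apply])
  have hsupp : p - q ∈ Finsupp.supported K K (P.expSet m I)ᶜ :=
    hpq ▸ add_mem (Finsupp.single_mem_supported K _ hα) hr
  obtain ⟨g, hgI, hg⟩ : p - q ∈ V := V.sub_mem ⟨f, hfI, rfl⟩ hqV
  -- The contradiction switches orderings: the reduction went along `m₁`, while the leading exponent
  -- of `p - q` is now taken for `m`.
  refine hsupp (exp_mem_support (m := m) hpq0) ⟨g, ⟨hgI, ?_⟩, ?_⟩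
  · rintro rfl
    exact hpq0 (by simpa using hg.symm)
  · rw [exp_eq hP, ← hg]
    rfl

end Relations

end GAlg

end

theorem corollary2p10 {K : Type*} [Field K] {n : ℕ} (P : GAlg.Relations K n) (hP : P.IsGAlgebra)
    (m : MonomialOrder (Fin n)) (hm : P.Admissible m)
    (I : Ideal P.Alg) (hI : I ≠ ⊥)
    (G : Finset P.Alg) (hG : P.IsGroebnerBasis m I G) :
    ∃ F : Finset (Fin n →₀ ℕ), ∀ m₁ : MonomialOrder (Fin n), P.Admissible m₁ →
      (∀ α ∈ F, ∀ β ∈ F, (β ≺[m] α ↔ β ≺[m₁] α)) →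
        (∀ g ∈ G, P.exp m g = P.exp m₁ g) ∧ P.IsGroebnerBasis m₁ I G := by
  classical
  -- `F` collects all exponents of the elements of `G`, not only the leading ones.
  refine ⟨G.biUnion fun g => (P.coeffs g).support, fun m₁ hm₁ hF => ?_⟩
  have hexp : ∀ g ∈ G, P.exp m g = P.exp m₁ g := fun g hg =>
    GAlg.Relations.exp_eq_exp fun α hα β hβ =>
      hF α (Finset.mem_biUnion.2 ⟨g, hg, hα⟩) β (Finset.mem_biUnion.2 ⟨g, hg, hβ⟩)
  have hunion : P.expSet m I =
      ⋃ g ∈ G, Set.range fun γ : Fin n →₀ ℕ => P.exp m₁ g + γ := by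
    rw [hG.expSet_eq]
    exact Set.iUnion₂_congr fun g hg => by rw [hexp g hg]
  have hsub : P.expSet m I ⊆ P.expSet m₁ I := by
    rw [hunion]
    refine Set.iUnion₂_subset fun g hg => ?_
    rintro _ ⟨γ, rfl⟩
    obtain ⟨hgI, hg0⟩ := hG.subset hg
    obtain ⟨h0, he⟩ := hm₁.exp_stdWord_mul hP hg0 γ
    -- The witness is `x^γ g`, a left multiple of `g`.
    exact ⟨_, ⟨I.mul_mem_left _ hgI, h0⟩, he⟩
  refine ⟨hexp, hG.subset, ?_⟩
  rw [← hunion]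
  exact (GAlg.Relations.expSet_subset_of_subset hP I hsub).antisymm hsub
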